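/- Let $K$ be a field, $R=K[x_1,\dots,x_n]$, and let $I\subset R$ be a nonzero proper monomial ideal without embedded associated primes, with minimal irreducible decomposition $I=\mathfrak q_1\cap\cdots\cap\mathfrak q_r$, i.e. the $\mathfrak q_j$ are irreducible monomial ideals with pairwise distinct radicals and none of them contains the intersection of the others. Write $\mathfrak q_j=\langle x_i^{w_{j,i}} : i\in A_j\rangle$ with $A_j\subset[n]=\{1,\dots,n\}$ and integers $w_{j,i}\ge 1$. Let $\mathcal H_I$ be the simple hypergraph on the vertex set $[n]$ (no edge contains another) whose cover ideal $\bigcap_{e}\langle x_i : i\in e\rangle$ (intersection over the edges $e$) is $\sqrt I$; its edges are $A_1,\dots,A_r$. Suppose that $\mathcal H_I$ is whiskered with whiskers $A_{j_1},\dots,A_{j_t}$ attached to the vertices $i_1,\dots,i_t$ respectively; that is, $A_{j_1},\dots,A_{j_t}$ are mutually disjoint edges and, with $V_1=\{i_1,\dots,i_t\}$, one has $A_j\subset V_1$ for all $j\ne j_1,\dots,j_t$, and $V_1\cap A_{j_k}=\{i_k\}$ for all $1\le k\le t$. Assume that (i) $w_{j_k,i}\ge w_{j_k,i_k}$ for all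 $1\le k\le t$ and all $i\in A_{j_k}$; and (ii) for each $j\ne j_1,\dots,j_t$ there exists $1\le k\le t$ with $i_k\in A_j$ and $w_{j,i_k}\le w_{j_k,i_k}$. Let $h$ be the big-height of $I$, i.e. the maximum of the heights of its associated primes. For a nonzero homogeneous ideal $L$ let $\alpha(L)$ be the least degree of a nonzero homogeneous element of $L$, and let $I^{(s)}=\bigcap_{\mathfrak p\in\mathrm{Ass}(I)}(I^sR_{\mathfrak p}\cap R)$ be the $s$-th symbolic power. Then the limit $\hat\alpha(I)=\lim_{s\to\infty}\alpha(I^{(s)})/s$ (the Waldschmidt constant of $I$) exists and $$\hat\alpha(I)\ \ge\ \frac{\alpha(I)+h-1}{h}.$$ -/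

import Mathlib

open Filter Topology

noncomputable section

namespace MonomialWaldschmidt

variable {n : ℕ} {K : Type*} [Field K]

/-- `I` is generated by monomials. -/
def IsMonomialIdeal (I : Ideal (MvPolynomial (Fin n) K)) : Prop :=
  ∃ S : Set (Fin n →₀ ℕ), I = Ideal.span ((fun a => MvPolynomial.monomial a (1 : K)) '' S)

/-- The associated primes of the ideal `I`, i.e. those of the module `R ⧸ I`. -/
def assPrimes (I : Ideal (MvPolynomial (Fin n) K)) : Set (Ideal (MvPolynomial (Fin n) K)) :=
  associatedPrimes (MvPolynomial (Fin n) K) (MvPolynomial (Fin n) K ⧸ I)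

/-- No associated prime of `I` strictly contains another one. -/
def HasNoEmbeddedPrimes (I : Ideal (MvPolynomial (Fin n) K)) : Prop :=
  ∀ p ∈ assPrimes I, ∀ p' ∈ assPrimes I, ¬ p' < p

/-- The big-height: the supremum of the heights of the associated primes. -/
def bigHeight (I : Ideal (MvPolynomial (Fin n) K)) : ℕ∞ :=
  ⨆ p ∈ assPrimes I, p.height

/-- The symbolic power `I^(s) = ⋂ (I^s R_p ∩ R)`, over the associated primes `p` of `I`. -/
def symbolicPower (I : Ideal (MvPolynomial (Fin n) K)) (s : ℕ) :
    Ideal (MvPolynomial (Fin n) K) :=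
  ⨅ (p : Ideal (MvPolynomial (Fin n) K)) (hp : p ∈ assPrimes I),
    haveI : p.IsPrime := IsAssociatedPrime.isPrime hp
    ((I ^ s).map (algebraMap (MvPolynomial (Fin n) K) (Localization.AtPrime p))).comap
      (algebraMap (MvPolynomial (Fin n) K) (Localization.AtPrime p))

/-- The initial degree `α(I)`: the least `d` such that `I` contains a nonzero form of degree `d`. -/
def alpha (I : Ideal (MvPolynomial (Fin n) K)) : ℕ :=
  sInf {d : ℕ | ∃ f ∈ I, f ≠ 0 ∧ f.IsHomogeneous d}

/-- The Waldschmidt constant `lim α(I^(s)) / s` (meaningful when the limit exists). -/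
def waldschmidtConstant (I : Ideal (MvPolynomial (Fin n) K)) : ℝ :=
  limUnder atTop (fun s : ℕ => (alpha (symbolicPower I s) : ℝ) / (s : ℝ))

/-- `I = q 1 ∩ ⋯ ∩ q r` with all `q j` irreducible monomial ideals, with pairwise distinct
radicals, and with no `q j` superfluous. -/
structure IsMinimalIrreducibleDecomposition {r : ℕ} (I : Ideal (MvPolynomial (Fin n) K))
    (q : Fin r → Ideal (MvPolynomial (Fin n) K)) : Prop where
  iInf_eq : I = ⨅ j, q j
  monomial : ∀ j, IsMonomialIdeal (q j)
  irreducible : ∀ j, InfIrred (q j)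
  radical_ne : ∀ j k, j ≠ k → (q j).radical ≠ (q k).radical
  irredundant : ∀ j, ¬ (⨅ k, ⨅ (_ : k ≠ j), q k) ≤ q j

variable (K) in
/-- The cover ideal of a hypergraph on `[n]`: the intersection, over the edges `e`, of the primes
generated by the variables indexed by `e`. -/
def coverIdeal (H : Hypergraph (Fin n)) : Ideal (MvPolynomial (Fin n) K) :=
  ⨅ e ∈ H.edgeSet, Ideal.span (MvPolynomial.X '' e)

/-- `H` is the hypergraph `H_I`: the (simple) hypergraph on `[n]` whose cover ideal is `√I`. -/
structure IsHypergraphOf (H : Hypergraph (Fin n)) (I : Ideal (MvPolynomial (Fin n) K)) :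
    Prop where
  vertexSet_eq : H.vertexSet = Set.univ
  simple : IsAntichain (· ⊆ ·) H.edgeSet
  coverIdeal_eq : coverIdeal K H = I.radical

/-- `H` is whiskered, with whiskers `B 1, …, B t` attached to the vertices `v 1, …, v t`. -/
structure IsWhiskeredWith (H : Hypergraph (Fin n)) {t : ℕ} (B : Fin t → Set (Fin n))
    (v : Fin t → Fin n) : Prop where
  whisker_mem : ∀ k, B k ∈ H.edgeSet
  disjoint : ∀ k l, k ≠ l → Disjoint (B k) (B l)
  edge_subset : ∀ e ∈ H.edgeSet, e ∉ Set.range B → e ⊆ Set.range v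
  inter_eq : ∀ k, Set.range v ∩ B k = {v k}

end MonomialWaldschmidt

end

open Filter Topology

/-! A single monomial pins the degree from both sides. Let `g` be the product over the whiskers of
x_{i_k} to the power w_{j_k,i_k}. Condition (ii) puts `g` in every component, so α(I) ≤ deg `g`. By
condition (i), `I` has order at least w_{j_k,i_k} in the variables of the k-th whisker; that order
is multiplicative and survives localization, so `I^(s)` has order at least s times as much
(`symbolicPower_le_orderIdeal`). The whiskers are disjoint, so these orders add up: α(I^(s)) ≥ s ·
deg `g` ≥ s · α(I). The limit, which exists by subadditivity, is thus at least α(I), and α(I) ≥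
(α(I) + h - 1)/h because α(I), h ≥ 1. -/

namespace MonomialWaldschmidt

/-! ### Order of vanishing along coordinate subspaces -/

section Order

variable {σ K : Type*} [Field K]

/-- The ideal of polynomials all of whose monomials have weight at least `N`. -/
def orderIdeal (c : σ → ℕ) (N : ℕ) : Ideal (MvPolynomial σ K) where
  carrier := {f | (N : ℕ∞) ≤ (f : MvPowerSeries σ K).weightedOrder c}
  zero_mem' := by simp
  add_mem' {f g} hf hg := by
    simp only [Set.mem_ofPred_eq, MvPolynomial.coe_add] at *
    exact (le_min hf hg).trans (MvPowerSeries.min_weightedOrder_le_add c)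
  smul_mem' u f hf := by
    simp only [Set.mem_ofPred_eq, smul_eq_mul, MvPolynomial.coe_mul,
      MvPowerSeries.weightedOrder_mul] at *
    exact hf.trans le_add_self

theorem mem_orderIdeal {c : σ → ℕ} {N : ℕ} {f : MvPolynomial σ K} :
    f ∈ orderIdeal c N ↔ (N : ℕ∞) ≤ (f : MvPowerSeries σ K).weightedOrder c := Iff.rfl

theorem mem_orderIdeal_iff_support {c : σ → ℕ} {N : ℕ} {f : MvPolynomial σ K} :
    f ∈ orderIdeal c N ↔ ∀ m ∈ f.support, N ≤ Finsupp.weight c m := by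
  rw [mem_orderIdeal]
  constructor
  · intro h m hm
    have := h.trans (MvPowerSeries.weightedOrder_le c (f := (f : MvPowerSeries σ K)) (d := m)
      (by simpa using hm))
    exact_mod_cast this
  · intro h
    refine MvPowerSeries.nat_le_weightedOrder c fun d hd => ?_
    by_contra hne
    exact absurd (h d (by simpa using hne)) (not_le.mpr hd)

theorem orderIdeal_pow_le (c : σ → ℕ) (N s : ℕ) :
    (orderIdeal c N : Ideal (MvPolynomial σ K)) ^ s ≤ orderIdeal c (s * N) := by
  induction s with
  | zero => intro f _; simp [mem_orderIdeal]
  | succ s ih =>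
    rw [pow_succ]
    refine Ideal.mul_le.mpr fun f hf g hg => ?_
    rw [mem_orderIdeal, MvPolynomial.coe_mul, MvPowerSeries.weightedOrder_mul, add_mul, one_mul,
      Nat.cast_add]
    exact add_le_add (ih hf) hg

/-- Orders add under multiplication and `u` has order 0. This is what lets order bounds pass through
localization at the prime `orderIdeal c 1`. -/
theorem mem_orderIdeal_of_mul_mem {c : σ → ℕ} {N : ℕ} {u f : MvPolynomial σ K}
    (hu : u ∉ orderIdeal c 1) (huf : u * f ∈ orderIdeal c N) : f ∈ orderIdeal c N := by
  have h0 : (u : MvPowerSeries σ K).weightedOrder c = 0 := by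
    rw [mem_orderIdeal, Nat.cast_one, Order.one_le_iff_ne_zero, not_not] at hu
    exact hu
  rwa [mem_orderIdeal, MvPolynomial.coe_mul, MvPowerSeries.weightedOrder_mul, h0, zero_add] at huf

theorem orderIdeal_one_isPrime (c : σ → ℕ) :
    (orderIdeal c 1 : Ideal (MvPolynomial σ K)).IsPrime where
  ne_top' := by
    rw [Ideal.ne_top_iff_one, mem_orderIdeal]
    simp
  mem_or_mem' {u f} huf := or_iff_not_imp_left.mpr fun hu => mem_orderIdeal_of_mul_mem hu huf

end Order

variable {n : ℕ} {K : Type*} [Field K]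

theorem weight_indicator (e : Set (Fin n)) (m : Fin n →₀ ℕ) :
    Finsupp.weight (e.indicator 1 : Fin n → ℕ) m = ∑ i, e.indicator m i := by
  rw [Finsupp.weight_apply, Finsupp.sum_fintype _ _ (by simp)]
  refine Finset.sum_congr rfl fun i _ => ?_
  by_cases hi : i ∈ e <;> simp [hi]

theorem span_X_image_eq_orderIdeal (e : Set (Fin n)) :
    Ideal.span (MvPolynomial.X '' e : Set (MvPolynomial (Fin n) K)) =
      orderIdeal (e.indicator 1) 1 := by
  ext f
  rw [MvPolynomial.mem_ideal_span_X_image, mem_orderIdeal_iff_support]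
  refine forall₂_congr fun m _ => ?_
  rw [weight_indicator, Nat.one_le_iff_ne_zero, Ne, Finset.sum_eq_zero_iff]
  simp

theorem X_pow_mem_orderIdeal {e : Set (Fin n)} {i : Fin n} (hi : i ∈ e) {N d : ℕ} (h : N ≤ d) :
    (MvPolynomial.X i ^ d : MvPolynomial (Fin n) K) ∈ orderIdeal (e.indicator 1) N := by
  rw [mem_orderIdeal_iff_support]
  intro m hm
  rw [MvPolynomial.support_X_pow, Finset.mem_singleton] at hm
  subst hm
  simpa [Finsupp.weight_single, hi] using h

/-- In a simple hypergraph, the primes of the edges are minimal over the cover ideal. -/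
theorem IsHypergraphOf.span_mem_minimalPrimes {H : Hypergraph (Fin n)}
    {I : Ideal (MvPolynomial (Fin n) K)} (hH : IsHypergraphOf H I) {e : Set (Fin n)}
    (he : e ∈ H.edgeSet) :
    Ideal.span (MvPolynomial.X '' e) ∈ I.minimalPrimes := by
  classical
  have hprime : (Ideal.span (MvPolynomial.X '' e : Set (MvPolynomial (Fin n) K))).IsPrime := by
    rw [span_X_image_eq_orderIdeal]
    exact orderIdeal_one_isPrime _
  -- A prime containing a finite intersection contains one of its members; the antichain condition
  -- then yields minimality.
  have hle : ∀ p : Ideal (MvPolynomial (Fin n) K), p.IsPrime → I ≤ p →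
      ∃ e' ∈ H.edgeSet, Ideal.span (MvPolynomial.X '' e') ≤ p := by
    intro p hp hIp
    have h1 : coverIdeal K H ≤ p := by
      rw [hH.coverIdeal_eq]
      exact hp.radical_le_iff.mpr hIp
    have h2 : coverIdeal K H = H.edgeSet.toFinite.toFinset.inf
        fun e => Ideal.span (MvPolynomial.X '' e) := by
      rw [Finset.inf_eq_iInf]
      simp [coverIdeal]
    rw [h2, hp.inf_le'] at h1
    simpa using h1
  refine ⟨⟨hprime, ?_⟩, ?_⟩
  · refine Ideal.le_radical.trans ?_
    rw [← hH.coverIdeal_eq]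
    exact iInf₂_le e he
  · rintro p ⟨hp, hIp⟩ hpe
    obtain ⟨e', he', hle'⟩ := hle p hp hIp
    have hsub : e' ⊆ e := by
      intro i hi
      have : (MvPolynomial.X i : MvPolynomial (Fin n) K) ∈
          Ideal.span (MvPolynomial.X '' e : Set (MvPolynomial (Fin n) K)) :=
        hpe (hle' (Ideal.subset_span ⟨i, hi, rfl⟩))
      rw [MvPolynomial.mem_ideal_span_X_image] at this
      obtain ⟨k, hk, hne⟩ := this (Finsupp.single i 1) (by simp [MvPolynomial.support_X])
      have : i = k := by
        by_contra hik
        exact hne (Finsupp.single_eq_of_ne (Ne.symm hik))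
      exact this ▸ hk
    have heq : e' = e := by
      by_contra hne
      exact hH.simple he' he hne hsub
    exact heq ▸ hle'

theorem mem_assPrimes_of_mem_minimalPrimes {I p : Ideal (MvPolynomial (Fin n) K)}
    (hp : p ∈ I.minimalPrimes) : p ∈ assPrimes I := by
  refine Module.associatedPrimes.minimalPrimes_annihilator_subset_associatedPrimes _ _ ?_
  rwa [Ideal.annihilator_quotient]

theorem one_le_bigHeight {I : Ideal (MvPolynomial (Fin n) K)} (h0 : I ≠ ⊥) (h1 : I ≠ ⊤) :
    1 ≤ bigHeight I := by
  obtain ⟨p, hp⟩ := Ideal.nonempty_minimalPrimes h1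
  refine le_trans ?_ (le_iSup₂_of_le p (mem_assPrimes_of_mem_minimalPrimes hp) le_rfl)
  rw [Order.one_le_iff_ne_zero, Ne, Ideal.height_eq_zero_iff_eq_bot]
  exact fun h => h0 (le_bot_iff.mp (h ▸ hp.1.2))

theorem IsHypergraphOf.span_mem_assPrimes {H : Hypergraph (Fin n)}
    {I : Ideal (MvPolynomial (Fin n) K)} (hH : IsHypergraphOf H I) {e : Set (Fin n)}
    (he : e ∈ H.edgeSet) : Ideal.span (MvPolynomial.X '' e) ∈ assPrimes I :=
  mem_assPrimes_of_mem_minimalPrimes (hH.span_mem_minimalPrimes he)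

/-! ### Symbolic powers and initial degrees -/

theorem mem_symbolicPower_iff {I : Ideal (MvPolynomial (Fin n) K)} {s : ℕ}
    {f : MvPolynomial (Fin n) K} :
    f ∈ symbolicPower I s ↔ ∀ p ∈ assPrimes I, ∃ u ∉ p, u * f ∈ I ^ s := by
  simp only [symbolicPower, Ideal.mem_iInf, Ideal.mem_comap]
  refine forall₂_congr fun p hp => ?_
  have : p.IsPrime := IsAssociatedPrime.isPrime hp
  rw [IsLocalization.algebraMap_mem_map_algebraMap_iff p.primeCompl]
  rfl

theorem pow_le_symbolicPower (I : Ideal (MvPolynomial (Fin n) K)) (s : ℕ) :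
    I ^ s ≤ symbolicPower I s := by
  intro f hf
  refine mem_symbolicPower_iff.mpr fun p hp => ⟨1, ?_, by simpa using hf⟩
  exact p.ne_top_iff_one.mp (IsAssociatedPrime.isPrime hp).ne_top

theorem mul_mem_symbolicPower {I : Ideal (MvPolynomial (Fin n) K)} {s t : ℕ}
    {f g : MvPolynomial (Fin n) K} (hf : f ∈ symbolicPower I s) (hg : g ∈ symbolicPower I t) :
    f * g ∈ symbolicPower I (s + t) := by
  rw [mem_symbolicPower_iff] at *
  intro p hp
  obtain ⟨u, hu, huf⟩ := hf p hp
  obtain ⟨v, hv, hvg⟩ := hg p hp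
  refine ⟨u * v, fun h => ((IsAssociatedPrime.isPrime hp).mem_or_mem h).elim hu hv, ?_⟩
  rw [mul_mul_mul_comm, pow_add]
  exact Ideal.mul_mem_mul huf hvg

theorem alpha_le {I : Ideal (MvPolynomial (Fin n) K)} {f : MvPolynomial (Fin n) K} {d : ℕ}
    (hf : f ∈ I) (h0 : f ≠ 0) (hd : f.IsHomogeneous d) : alpha I ≤ d :=
  Nat.sInf_le ⟨f, hf, h0, hd⟩

theorem exists_isHomogeneous_alpha {I : Ideal (MvPolynomial (Fin n) K)}
    (h : ∃ d, ∃ f ∈ I, f ≠ 0 ∧ f.IsHomogeneous d) :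
    ∃ f ∈ I, f ≠ 0 ∧ f.IsHomogeneous (alpha I) :=
  Nat.sInf_mem (s := {d : ℕ | ∃ f ∈ I, f ≠ 0 ∧ f.IsHomogeneous d}) h

theorem one_le_alpha {I : Ideal (MvPolynomial (Fin n) K)} (hI : I ≠ ⊤)
    (h : ∃ d, ∃ f ∈ I, f ≠ 0 ∧ f.IsHomogeneous d) : 1 ≤ alpha I := by
  obtain ⟨f, hf, h0, hd⟩ := exists_isHomogeneous_alpha h
  by_contra hlt
  rw [Nat.lt_one_iff.mp (not_le.mp hlt), ← MvPolynomial.totalDegree_zero_iff_isHomogeneous,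
    MvPolynomial.totalDegree_eq_zero_iff_eq_C] at hd
  rw [hd] at hf h0
  refine hI (Ideal.eq_top_of_isUnit_mem _ hf (IsUnit.map _ (Ne.isUnit fun hc => h0 ?_)))
  rw [hc, map_zero]

theorem exists_isHomogeneous_symbolicPower {I : Ideal (MvPolynomial (Fin n) K)}
    (h : ∃ d, ∃ f ∈ I, f ≠ 0 ∧ f.IsHomogeneous d) (s : ℕ) :
    ∃ d, ∃ f ∈ symbolicPower I s, f ≠ 0 ∧ f.IsHomogeneous d := by
  obtain ⟨d, f, hf, h0, hd⟩ := h
  exact ⟨_, f ^ s, pow_le_symbolicPower I s (Ideal.pow_mem_pow hf s), pow_ne_zero s h0, hd.pow s⟩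

theorem subadditive_alpha_symbolicPower {I : Ideal (MvPolynomial (Fin n) K)}
    (h : ∃ d, ∃ f ∈ I, f ≠ 0 ∧ f.IsHomogeneous d) :
    Subadditive fun s => (alpha (symbolicPower I s) : ℝ) := by
  intro s t
  obtain ⟨f, hf, hf0, hfd⟩ :=
    exists_isHomogeneous_alpha (exists_isHomogeneous_symbolicPower h s)
  obtain ⟨g, hg, hg0, hgd⟩ :=
    exists_isHomogeneous_alpha (exists_isHomogeneous_symbolicPower h t)
  simp only
  exact_mod_cast alpha_le (mul_mem_symbolicPower hf hg) (mul_ne_zero hf0 hg0) (hfd.mul hgd)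

/-- The limit defining the Waldschmidt constant exists. -/
theorem tendsto_waldschmidtConstant {I : Ideal (MvPolynomial (Fin n) K)}
    (h : ∃ d, ∃ f ∈ I, f ≠ 0 ∧ f.IsHomogeneous d) :
    Tendsto (fun s : ℕ => (alpha (symbolicPower I s) : ℝ) / s) atTop
      (𝓝 (waldschmidtConstant I)) := by
  -- Fekete's lemma; the ratios are bounded below by 0.
  refine tendsto_nhds_limUnder ⟨_, (subadditive_alpha_symbolicPower h).tendsto_lim ⟨0, ?_⟩⟩
  rintro _ ⟨s, rfl⟩
  positivity

theorem symbolicPower_le_orderIdeal {I : Ideal (MvPolynomial (Fin n) K)} {e : Set (Fin n)}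
    (he : Ideal.span (MvPolynomial.X '' e) ∈ assPrimes I) {N : ℕ}
    (hI : I ≤ orderIdeal (e.indicator 1) N) (s : ℕ) :
    symbolicPower I s ≤ orderIdeal (e.indicator 1) (s * N) := by
  intro f hf
  obtain ⟨u, hu, huf⟩ := mem_symbolicPower_iff.mp hf _ he
  rw [span_X_image_eq_orderIdeal] at hu
  exact mem_orderIdeal_of_mul_mem hu
    (orderIdeal_pow_le _ _ _ (Ideal.pow_right_mono hI s huf))

/-- If `I` has order at least `N k` along each of the disjoint associated coordinate subspaces
`B k`, then `I^(s)` starts in degree at least `s * ∑ N k`. -/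
theorem mul_sum_le_alpha_symbolicPower {I : Ideal (MvPolynomial (Fin n) K)}
    (h : ∃ d, ∃ f ∈ I, f ≠ 0 ∧ f.IsHomogeneous d) {ι : Type*} [Fintype ι] {B : ι → Set (Fin n)}
    (hB : ∀ k l, k ≠ l → Disjoint (B k) (B l))
    (hass : ∀ k, Ideal.span (MvPolynomial.X '' B k) ∈ assPrimes I) {N : ι → ℕ}
    (hI : ∀ k, I ≤ orderIdeal ((B k).indicator 1) (N k)) (s : ℕ) :
    s * ∑ k, N k ≤ alpha (symbolicPower I s) := by
  classical
  obtain ⟨f, hf, h0, hd⟩ := exists_isHomogeneous_alpha (exists_isHomogeneous_symbolicPower h s)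
  obtain ⟨m, hm⟩ := MvPolynomial.support_nonempty.mpr h0
  have hdeg : ∑ i, m i = alpha (symbolicPower I s) := by
    rw [← Finsupp.degree_eq_sum]
    rw [Finsupp.degree_eq_weight_one (R := ℕ)]
    exact hd (MvPolynomial.mem_support_iff.mp hm)
  calc s * ∑ k, N k = ∑ k, s * N k := Finset.mul_sum _ _ _
    _ ≤ ∑ k, ∑ i, (B k).indicator m i := Finset.sum_le_sum fun k _ => by
        rw [← weight_indicator]
        exact mem_orderIdeal_iff_support.mp
          (symbolicPower_le_orderIdeal (hass k) (hI k) s hf) m hm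
    _ = ∑ i, ∑ k, (B k).indicator m i := Finset.sum_comm
    -- By disjointness each variable is counted for at most one `k`.
    _ ≤ ∑ i, m i := Finset.sum_le_sum fun i _ => by
        by_cases hi : ∃ k, i ∈ B k
        · obtain ⟨k, hk⟩ := hi
          rw [Finset.sum_eq_single k]
          · exact Set.indicator_le_self _ _ _
          · intro l _ hl
            exact Set.indicator_of_notMem (fun hil => (hB l k hl).notMem_of_mem_left hil hk) _
          · simp
        · push Not at hi
          simp [hi]
    _ = _ := hdeg

end MonomialWaldschmidt

theorem mainTheorem2 {n : ℕ} {K : Type*} [Field K]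
    (I : Ideal (MvPolynomial (Fin n) K)) (hI0 : I ≠ ⊥) (hI1 : I ≠ ⊤)
    (hmon : MonomialWaldschmidt.IsMonomialIdeal I)
    (hemb : MonomialWaldschmidt.HasNoEmbeddedPrimes I)
    {r : ℕ} (q : Fin r → Ideal (MvPolynomial (Fin n) K))
    (hq : MonomialWaldschmidt.IsMinimalIrreducibleDecomposition I q)
    (A : Fin r → Finset (Fin n)) (w : Fin r → Fin n → ℕ)
    (hw : ∀ j, ∀ i ∈ A j, 0 < w j i)
    (hqA : ∀ j, q j = Ideal.span
      ((fun i => (MvPolynomial.X i : MvPolynomial (Fin n) K) ^ w j i) '' (A j : Set (Fin n))))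
    (H : Hypergraph (Fin n)) (hH : MonomialWaldschmidt.IsHypergraphOf H I)
    {t : ℕ} (j : Fin t → Fin r) (v : Fin t → Fin n)
    (hwh : MonomialWaldschmidt.IsWhiskeredWith H (fun k => (A (j k) : Set (Fin n))) v)
    (h1 : ∀ k, ∀ i ∈ A (j k), w (j k) (v k) ≤ w (j k) i)
    (h2 : ∀ l : Fin r, l ∉ Set.range j → ∃ k, v k ∈ A l ∧ w l (v k) ≤ w (j k) (v k))
    (h : ℕ) (hh : MonomialWaldschmidt.bigHeight I = (h : ℕ∞)) :
    Filter.Tendsto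
        (fun s : ℕ => (MonomialWaldschmidt.alpha (MonomialWaldschmidt.symbolicPower I s) : ℝ) / s)
        Filter.atTop (nhds (MonomialWaldschmidt.waldschmidtConstant I)) ∧
      ((MonomialWaldschmidt.alpha I : ℝ) + h - 1) / h
        ≤ MonomialWaldschmidt.waldschmidtConstant I := by
  open MonomialWaldschmidt in
  have hv : ∀ k, v k ∈ A (j k) := fun k => by
    have : v k ∈ Set.range v ∩ (A (j k) : Set (Fin n)) := by rw [hwh.inter_eq k]; rfl
    exact this.2
  set g : MvPolynomial (Fin n) K := ∏ k, MvPolynomial.X (v k) ^ w (j k) (v k) with hg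
  have hX : ∀ k, (MvPolynomial.X (v k) ^ w (j k) (v k) : MvPolynomial (Fin n) K) ∣ g :=
    fun k => Finset.dvd_prod_of_mem _ (Finset.mem_univ k)
  have hgI : g ∈ I := by
    rw [hq.iInf_eq, Ideal.mem_iInf]
    intro l
    -- A whisker uses its own attaching vertex; any other component uses condition (ii).
    obtain ⟨k, hk, hle⟩ : ∃ k, v k ∈ A l ∧ w l (v k) ≤ w (j k) (v k) := by
      by_cases hl : l ∈ Set.range j
      · obtain ⟨k, rfl⟩ := hl
        exact ⟨k, hv k, le_rfl⟩
      · exact h2 l hl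
    refine Ideal.mem_of_dvd _ ((pow_dvd_pow _ hle).trans (hX k)) ?_
    rw [hqA]
    exact Ideal.subset_span ⟨v k, hk, rfl⟩
  have hg0 : g ≠ 0 := Finset.prod_ne_zero_iff.mpr fun k _ => pow_ne_zero _ (MvPolynomial.X_ne_zero _)
  have hgd : g.IsHomogeneous (∑ k, w (j k) (v k)) :=
    MvPolynomial.IsHomogeneous.prod _ _ _ fun k _ => MvPolynomial.isHomogeneous_X_pow _ _
  have hne : ∃ d, ∃ f ∈ I, f ≠ 0 ∧ f.IsHomogeneous d := ⟨_, g, hgI, hg0, hgd⟩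
  have hlim := tendsto_waldschmidtConstant hne
  refine ⟨hlim, ?_⟩
  -- Condition (i) bounds the order of each generator of the whisker's component.
  have hord : ∀ k, I ≤ orderIdeal ((A (j k) : Set (Fin n)).indicator 1) (w (j k) (v k)) := by
    intro k
    rw [hq.iInf_eq]
    refine (iInf_le _ (j k)).trans ?_
    rw [hqA, Ideal.span_le]
    rintro _ ⟨i, hi, rfl⟩
    exact X_pow_mem_orderIdeal hi (h1 k i hi)
  have hlow : (alpha I : ℝ) ≤ waldschmidtConstant I := by
    refine ge_of_tendsto hlim (eventually_atTop.mpr ⟨1, fun s hs => ?_⟩)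
    rw [le_div_iff₀ (by exact_mod_cast hs), mul_comm]
    exact_mod_cast (Nat.mul_le_mul_left s (alpha_le hgI hg0 hgd)).trans
      (mul_sum_le_alpha_symbolicPower hne hwh.disjoint
        (fun k => hH.span_mem_assPrimes (hwh.whisker_mem k)) hord s)
  refine le_trans ?_ hlow
  have hα : (1 : ℝ) ≤ alpha I := by exact_mod_cast one_le_alpha hI1 hne
  have hh1 : (1 : ℝ) ≤ h := by
    have := hh ▸ one_le_bigHeight hI0 hI1
    exact_mod_cast this
  rw [div_le_iff₀ (by linarith)]
  -- The inequality α + h - 1 ≤ α h is (α - 1)(h - 1) ≥ 0.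
  nlinarith [mul_nonneg (sub_nonneg.mpr hα) (sub_nonneg.mpr hh1)]
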